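/- Let $q\ge 3$, $b\ge 2$ and $H\ge 0$ be integers, let $T$ be the complete $b$-ary tree of height $H$ (every non-leaf has exactly $b$ children and every leaf is at distance $H$ from the root), and let $n=(b^{H+1}-1)/(b-1)$ be its number of vertices. Let $\mathcal M$ be the Metropolis Glauber dynamics on the set $\Omega$ of proper $q$-colourings of $T$: one step selects a vertex $v$ and one of the $q$ colours $c$ uniformly at random, and recolours $v$ with $c$ if and only if the result is a proper colouring. Let $P$ be its transition matrix and $\pi$ the uniform distribution on $\Omega$. For $\delta>0$ let $$\tau(\mathcal M,\delta)=\max_{x\in\Omega}\ \min\Big\{t>0:\ \tfrac12\sum_{y\in\Omega}\big|P^{t'}(x,y)-\pi(y)\big|\le\delta\ \text{ for all } t'\ge t\Big\}.$$ Then for fixed $q$ and $b$ the mixing time $\tau(\mathcal M,1/(2e))$ is finite and is $n^{O(b/\log b)}$, where the constant implicit in the $O(\cdot)$ does not depend on $n$, $q$ or $b$; that is, there is a constant $C>0$ such that for all $q\ge3$ and $b\ge2$ there is an $N$ such that $\tau(\mathcal M,1/(2e))\le n^{C\,b/\ln b}$ whenever $n\ge N$. In particular, for all $q\ge 3$, $b\ge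 2$ and $H\ge 0$, $$\tau(\mathcal M,1/(2e))\ \le\ 3\,b\,q^2\,(1+\lg n)\,n^{3+\frac{3b}{\ln b}},$$ where $\lg$ is the logarithm to base $2$ and $\ln$ is the natural logarithm. -/

import Mathlib

noncomputable section

/-! ## The complete `b`-ary tree -/

/-- The vertices of the complete `b`-ary tree of height `H`: a vertex is the word of length at
most `H` recording which child is taken at each step of the path from the root to that vertex.
The root is the empty word and the leaves are the words of length `H`. -/
abbrev TreeVertex (b H : ℕ) : Type := {w : List (Fin b) // w.length ≤ H}

instance instFintypeTreeVertex (b H : ℕ) : Fintype (TreeVertex b H) :=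
  (List.finite_length_le (Fin b) H).fintype

/-- The complete `b`-ary tree of height `H`: the children of the vertex `u` are the vertices
`u ++ [i]` with `i : Fin b`. -/
def completeTree (b H : ℕ) : SimpleGraph (TreeVertex b H) where
  Adj u v := (∃ i : Fin b, v.1 = u.1 ++ [i]) ∨ (∃ i : Fin b, u.1 = v.1 ++ [i])
  symm := ⟨fun _ _ h => h.symm⟩
  loopless := ⟨fun u h => by
    rcases h with ⟨i, h⟩ | ⟨i, h⟩ <;> simpa using congrArg List.length h⟩

/-! ## Mixing times of finite Markov chains -/

section MixingTime

variable {Ω : Type*} [Fintype Ω]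

/-- The uniform distribution on a finite state space. -/
def uniformDist (Ω : Type*) [Fintype Ω] : Ω → ℝ := fun _ => 1 / (Fintype.card Ω : ℝ)

/-- The variation distance between two distributions on a finite state space. -/
def variationDist (θ₁ θ₂ : Ω → ℝ) : ℝ := (1 / 2) * ∑ i, |θ₁ i - θ₂ i|

/-- The mixing time from the starting state `x` of the chain with transition matrix `P` and
stationary distribution `π`: the least `t > 0` such that the distribution after `t'` steps is
within variation distance `δ` of `π` for every `t' ≥ t` (and `⊤` if there is no such `t`). -/
def mixingTimeFrom [DecidableEq Ω] (P : Matrix Ω Ω ℝ) (π : Ω → ℝ) (x : Ω) (δ : ℝ) : ℕ∞ :=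
  ⨅ t ∈ {t : ℕ | 0 < t ∧ ∀ t' : ℕ, t ≤ t' → variationDist ((P ^ t') x) π ≤ δ}, (t : ℕ∞)

/-- The mixing time: the maximum over all starting states of the mixing time from that state. -/
def mixingTime [DecidableEq Ω] (P : Matrix Ω Ω ℝ) (π : Ω → ℝ) (δ : ℝ) : ℕ∞ :=
  ⨆ x : Ω, mixingTimeFrom P π x δ

end MixingTime

/-! ## Metropolis Glauber dynamics on proper colourings -/

section Glauber

variable {V : Type*} [Fintype V] [DecidableEq V]

open Classical in
/-- Recolour the vertex `p.1` with the colour `p.2` if this results in a proper colouring;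
otherwise leave the colouring `x` unchanged. -/
def metropolisMove (G : SimpleGraph V) (q : ℕ) (x : G.Coloring (Fin q)) (p : V × Fin q) :
    G.Coloring (Fin q) :=
  if h : ∀ u v : V, G.Adj u v → Function.update x p.1 p.2 u ≠ Function.update x p.1 p.2 v then
    SimpleGraph.Coloring.mk (Function.update x p.1 p.2) (fun {u v} huv => h u v huv)
  else x

open Classical in
/-- The transition matrix of the Metropolis Glauber dynamics on the proper `q`-colourings of `G`:
a pair (vertex, colour) is selected uniformly at random, and the corresponding move is made. -/
def glauberMatrix (G : SimpleGraph V) (q : ℕ) :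
    Matrix (G.Coloring (Fin q)) (G.Coloring (Fin q)) ℝ :=
  fun x y => ((Finset.univ.filter fun p : V × Fin q => metropolisMove G q x p = y).card : ℝ) /
    ((Fintype.card V : ℝ) * (q : ℝ))

open Classical in
/-- The mixing time `τ(M, δ)` of the Metropolis Glauber dynamics on the proper `q`-colourings
of `G`, whose stationary distribution is uniform. -/
def glauberMixingTime (G : SimpleGraph V) (q : ℕ) (δ : ℝ) : ℕ∞ :=
  mixingTime (glauberMatrix G q) (uniformDist (G.Coloring (Fin q))) δ

end Glauber

end

/-! The proof bounds the spectral gap by induction on the height. Let `κ` be a Poincaré constant,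
normalised as in `PoincareOn`, valid at height `H` for every set of allowed root colours. At height
`H + 1`, once the root has colour `c`, the `b` subtrees are independent, each avoiding `c` at its
own root. A product of `b` such factors has constant at most `2 ^ b * κ` (`PoincareOn.pi`).

To change the root colour, let `U c` be the subtree colourings whose root avoids `c`. As `q ≥ 3`,
any two of these equally large sets share at least half their elements
(`card_properColourings_inter`), so their `b`-th powers share a fraction at least `2⁻ᵇ`. Routing
through the common part costs a further `6 * 2 ^ b` (`PoincareOn.sigma`). Each level thus costs `6 *
4 ^ b ≤ exp (3 * b)`, and `H` levels at most `(b ^ H) ^ (3b / ln b) ≤ n ^ (3b / ln b)`.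

A move of the chain has probability `1 / (n * q)`, so the gap is at least `1 / (n * q * κ)`.
Together with `|Ω| ≤ q ^ n`, the L² bound `mixingTime_le_of_gap` finishes the proof. -/

open Finset in
open Classical in
/-- The Poincaré inequality with constant `κ` for the uniform distribution on `S` and the
Dirichlet form in which `x` and `y` are joined whenever `R x y`. -/
def PoincareOn {X : Type*} (S : Finset X) (R : X → X → Prop) (κ : ℝ) : Prop :=
  ∀ f : X → ℝ, ∑ x ∈ S, ∑ y ∈ S, (f x - f y) ^ 2 ≤
    κ * (#S : ℝ) * ∑ x ∈ S, ∑ y ∈ S, if R x y then (f x - f y) ^ 2 else 0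

/-! ### Poincaré inequalities for products and for overlapping fibres. -/

namespace PoincareOn

open Finset
open scoped Classical

variable {X Y : Type*}

/-- The base of the induction: at height 0 there is one vertex, so distinct colourings are always
one move apart. -/
theorem of_forall_ne {S : Finset X} {R : X → X → Prop} (hR : ∀ x y, x ≠ y → R x y) :
    PoincareOn S R 1 := by
  intro f
  rcases S.eq_empty_or_nonempty with rfl | hS
  · simp
  have h1 : (1 : ℝ) ≤ #S := by exact_mod_cast hS.card_pos
  have h2 : ∑ x ∈ S, ∑ y ∈ S, (f x - f y) ^ 2 =
      ∑ x ∈ S, ∑ y ∈ S, if R x y then (f x - f y) ^ 2 else 0 := by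
    refine sum_congr rfl fun x _ => sum_congr rfl fun y _ => ?_
    split_ifs with h
    · rfl
    · have : x = y := by
        by_contra hne
        exact h (hR x y hne)
      simp [this]
  rw [← h2, one_mul]
  exact le_mul_of_one_le_left (by positivity) h1

theorem mono {S : Finset X} {R : X → X → Prop} {κ κ' : ℝ} (h : PoincareOn S R κ) (hκ : κ ≤ κ') :
    PoincareOn S R κ' := by
  intro f
  refine (h f).trans ?_
  have : 0 ≤ ∑ x ∈ S, ∑ y ∈ S, if R x y then (f x - f y) ^ 2 else 0 :=
    sum_nonneg fun x _ => sum_nonneg fun y _ => by split_ifs <;> positivity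
  gcongr

theorem transport {S : Finset X} {R : X → X → Prop} {R' : Y → Y → Prop} {κ : ℝ} (hκ : 0 ≤ κ)
    (h : PoincareOn S R κ) (e : X ↪ Y) (hR : ∀ x y, R x y → R' (e x) (e y)) :
    PoincareOn (S.map e) R' κ := by
  intro f
  simp only [sum_map, card_map]
  refine (h fun x => f (e x)).trans ?_
  gcongr with x _ y _
  split_ifs with h1 h2
  · rfl
  · exact absurd (hR _ _ h1) h2
  · positivity
  · rfl

/-- The relation on a product in which one coordinate moves. -/
def Box (R : X → X → Prop) (R' : Y → Y → Prop) (p p' : X × Y) : Prop :=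
  (R p.1 p'.1 ∧ p.2 = p'.2) ∨ (p.1 = p'.1 ∧ R' p.2 p'.2)

/-- Go from `(x, y)` to `(x', y')` through `(x', y)`. The factor 2 is that of `(s + t)² ≤ 2s² +
2t²`; tensorising variances would avoid it, but the loss is affordable. -/
theorem prod {S : Finset X} {T : Finset Y} {R : X → X → Prop} {R' : Y → Y → Prop} {κ : ℝ}
    (hκ : 0 ≤ κ) (hS : PoincareOn S R κ) (hT : PoincareOn T R' κ) :
    PoincareOn (S ×ˢ T) (Box R R') (2 * κ) := by
  intro f
  simp only [sum_product, card_product, Nat.cast_mul]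
  have key : ∀ x ∈ S, ∀ y ∈ T, ∀ x' ∈ S, ∀ y' ∈ T, (f (x, y) - f (x', y')) ^ 2 ≤
      2 * (f (x, y) - f (x', y)) ^ 2 + 2 * (f (x', y) - f (x', y')) ^ 2 := by
    intro x _ y _ x' _ y' _
    nlinarith [sq_nonneg ((f (x, y) - f (x', y)) - (f (x', y) - f (x', y')))]
  have h1 : ∑ x ∈ S, ∑ y ∈ T, ∑ x' ∈ S, ∑ y' ∈ T, (f (x, y) - f (x', y')) ^ 2 ≤
      2 * (#T * ∑ y ∈ T, ∑ x ∈ S, ∑ x' ∈ S, (f (x, y) - f (x', y)) ^ 2) +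
      2 * (#S * ∑ x ∈ S, ∑ y ∈ T, ∑ y' ∈ T, (f (x, y) - f (x, y')) ^ 2) := by
    calc _ ≤ ∑ x ∈ S, ∑ y ∈ T, ∑ x' ∈ S, ∑ y' ∈ T,
          (2 * (f (x, y) - f (x', y)) ^ 2 + 2 * (f (x', y) - f (x', y')) ^ 2) :=
          sum_le_sum fun x hx => sum_le_sum fun y hy => sum_le_sum fun x' hx' =>
            sum_le_sum fun y' hy' => key x hx y hy x' hx' y' hy'
      _ = _ := by
        simp only [sum_add_distrib, sum_const, nsmul_eq_mul, ← mul_sum]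
        congr 1
        · rw [sum_comm (s := T) (t := S)]
          ring
        · rw [sum_comm (s := T) (t := S)]
          ring
  have h2 : ∑ y ∈ T, ∑ x ∈ S, ∑ x' ∈ S, (f (x, y) - f (x', y)) ^ 2 ≤
      κ * #S * ∑ y ∈ T, ∑ x ∈ S, ∑ x' ∈ S, if R x x' then (f (x, y) - f (x', y)) ^ 2 else 0 := by
    rw [mul_sum]
    exact sum_le_sum fun y _ => hS fun x => f (x, y)
  have h3 : ∑ x ∈ S, ∑ y ∈ T, ∑ y' ∈ T, (f (x, y) - f (x, y')) ^ 2 ≤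
      κ * #T * ∑ x ∈ S, ∑ y ∈ T, ∑ y' ∈ T, if R' y y' then (f (x, y) - f (x, y')) ^ 2 else 0 := by
    rw [mul_sum]
    exact sum_le_sum fun x _ => hT fun y => f (x, y)
  have h4 : (∑ y ∈ T, ∑ x ∈ S, ∑ x' ∈ S, if R x x' then (f (x, y) - f (x', y)) ^ 2 else 0) +
      (∑ x ∈ S, ∑ y ∈ T, ∑ y' ∈ T, if R' y y' then (f (x, y) - f (x, y')) ^ 2 else 0) ≤
      ∑ x ∈ S, ∑ y ∈ T, ∑ x' ∈ S, ∑ y' ∈ T,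
        if Box R R' (x, y) (x', y') then (f (x, y) - f (x', y')) ^ 2 else 0 := by
    rw [sum_comm (s := T) (t := S), ← sum_add_distrib]
    refine sum_le_sum fun x hx => ?_
    rw [← sum_add_distrib]
    refine sum_le_sum fun y hy => ?_
    have e1 : (∑ x' ∈ S, if R x x' then (f (x, y) - f (x', y)) ^ 2 else 0) =
        ∑ x' ∈ S, ∑ y' ∈ T,
          if y = y' then (if R x x' then (f (x, y) - f (x', y')) ^ 2 else 0) else 0 :=
      sum_congr rfl fun x' _ => by rw [sum_ite_eq]; simp [hy]
    have e2 : (∑ y' ∈ T, if R' y y' then (f (x, y) - f (x, y')) ^ 2 else 0) =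
        ∑ x' ∈ S, ∑ y' ∈ T,
          if x = x' then (if R' y y' then (f (x, y) - f (x', y')) ^ 2 else 0) else 0 := by
      rw [sum_comm]
      exact sum_congr rfl fun y' _ => by rw [sum_ite_eq]; simp [hx]
    rw [e1, e2, ← sum_add_distrib]
    refine sum_le_sum fun x' _ => ?_
    rw [← sum_add_distrib]
    refine sum_le_sum fun y' _ => ?_
    -- Both kinds of move are counted only if `x = x'` and `y = y'`, where the difference vanishes.
    by_cases hy' : y = y' <;> by_cases hx' : x = x' <;> simp [Box, hx', hy']
  have hST : (0 : ℝ) ≤ 2 * κ * (#S * #T) := by positivity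
  calc _ ≤ _ := h1
    _ ≤ 2 * (#T * (κ * #S * ∑ y ∈ T, ∑ x ∈ S, ∑ x' ∈ S,
            if R x x' then (f (x, y) - f (x', y)) ^ 2 else 0)) +
        2 * (#S * (κ * #T * ∑ x ∈ S, ∑ y ∈ T, ∑ y' ∈ T,
            if R' y y' then (f (x, y) - f (x, y')) ^ 2 else 0)) := by gcongr
    _ = 2 * κ * (#S * #T) * (_ + _) := by rw [mul_add]; ring
    _ ≤ _ := mul_le_mul_of_nonneg_left h4 hST

/-- The relation on a power in which exactly one coordinate moves. -/
def Coord {ι : Type*} (R : X → X → Prop) (x y : ι → X) : Prop :=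
  ∃ i, R (x i) (y i) ∧ ∀ j, j ≠ i → x j = y j

/-- Each added coordinate doubles the constant, by `prod`. -/
theorem pi {S : Finset X} {R : X → X → Prop} {κ : ℝ} (hκ : 0 ≤ κ) (hS : PoincareOn S R κ)
    (n : ℕ) : PoincareOn (Fintype.piFinset fun _ : Fin n => S) (Coord R) (2 ^ n * κ) := by
  induction n with
  | zero =>
    intro f
    rw [sum_eq_zero]
    · exact mul_nonneg (by positivity) (sum_nonneg fun x _ => sum_nonneg fun y _ => by
        split_ifs <;> positivity)
    · intro x _
      refine sum_eq_zero fun y _ => ?_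
      simp [Subsingleton.elim x y]
  | succ n ih =>
    have h1 : κ ≤ 2 ^ n * κ := le_mul_of_one_le_left hκ (one_le_pow₀ (by norm_num))
    have h := ((hS.mono h1).prod (by positivity) ih).transport (by positivity)
      (Fin.consEquiv fun _ : Fin (n + 1) => X).toEmbedding (R' := Coord R) (by
        rintro ⟨x, u⟩ ⟨y, v⟩ (⟨h, h'⟩ | ⟨h, i, hi, h'⟩)
        · refine ⟨0, h, fun j hj => ?_⟩
          obtain ⟨k, rfl⟩ := Fin.exists_succ_eq.2 hj
          exact congrFun h' k
        · refine ⟨i.succ, hi, fun j => ?_⟩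
          refine Fin.cases (fun _ => h) (fun k hk => ?_) j
          exact h' k fun e => hk (congrArg _ e))
    have e : (S ×ˢ Fintype.piFinset fun _ : Fin n => S).map
        (Fin.consEquiv fun _ : Fin (n + 1) => X).toEmbedding =
        Fintype.piFinset fun _ : Fin (n + 1) => S := by
      ext x
      rw [mem_map_equiv]
      simp [Fin.forall_fin_succ, Fin.consEquiv, Fin.tail]
    rw [e, ← mul_assoc, ← pow_succ'] at h
    exact h

/-- Average over `z` in the overlap the path `u x`, `u z`, `v z`, `v y`. Three increments give the
3, and `L` pays for averaging over the overlap instead of a whole set. -/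
theorem sum_sq_sub_le {Q Q' : Finset Y} {N : ℕ} {L : ℝ} (hL : 0 ≤ L) (hQ : #Q = N) (hQ' : #Q' = N)
    (hW : (N : ℝ) ≤ L * #(Q ∩ Q')) (u v : Y → ℝ) :
    ∑ x ∈ Q, ∑ y ∈ Q', (u x - v y) ^ 2 ≤ 3 * L * (∑ x ∈ Q, ∑ y ∈ Q, (u x - u y) ^ 2 +
      ∑ x ∈ Q', ∑ y ∈ Q', (v x - v y) ^ 2 + N * ∑ z ∈ Q ∩ Q', (u z - v z) ^ 2) := by
  rcases Nat.eq_zero_or_pos N with h0 | hN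
  · rw [h0] at hQ hQ'
    simp [card_eq_zero.1 hQ, card_eq_zero.1 hQ']
  have hN' : (0 : ℝ) < N := by exact_mod_cast hN
  set W := Q ∩ Q'
  have key : #W * ∑ x ∈ Q, ∑ y ∈ Q', (u x - v y) ^ 2 ≤
      3 * N * (∑ x ∈ Q, ∑ y ∈ Q, (u x - u y) ^ 2 +
      ∑ x ∈ Q', ∑ y ∈ Q', (v x - v y) ^ 2 + N * ∑ z ∈ W, (u z - v z) ^ 2) := by
    calc #W * ∑ x ∈ Q, ∑ y ∈ Q', (u x - v y) ^ 2
        = ∑ x ∈ Q, ∑ y ∈ Q', ∑ z ∈ W, (u x - v y) ^ 2 := by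
          simp only [sum_const, nsmul_eq_mul, mul_sum]
      _ ≤ ∑ x ∈ Q, ∑ y ∈ Q', ∑ z ∈ W,
          (3 * (u x - u z) ^ 2 + 3 * (u z - v z) ^ 2 + 3 * (v y - v z) ^ 2) := by
          refine sum_le_sum fun x _ => sum_le_sum fun y _ => sum_le_sum fun z _ => ?_
          nlinarith [sq_nonneg ((u x - u z) - (u z - v z)), sq_nonneg ((u x - u z) - (v z - v y)),
            sq_nonneg ((u z - v z) - (v z - v y))]
      _ = 3 * N * (∑ x ∈ Q, ∑ z ∈ W, (u x - u z) ^ 2 +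
          ∑ y ∈ Q', ∑ z ∈ W, (v y - v z) ^ 2 + N * ∑ z ∈ W, (u z - v z) ^ 2) := by
          simp only [sum_add_distrib, sum_const, nsmul_eq_mul, ← mul_sum, hQ, hQ']
          ring
      _ ≤ _ := by
          gcongr
          · exact inter_subset_left
          · exact inter_subset_right
  have hnn : 0 ≤ ∑ x ∈ Q, ∑ y ∈ Q', (u x - v y) ^ 2 := by positivity
  have h2 : N * ∑ x ∈ Q, ∑ y ∈ Q', (u x - v y) ^ 2 ≤
      N * (3 * L * (∑ x ∈ Q, ∑ y ∈ Q, (u x - u y) ^ 2 +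
      ∑ x ∈ Q', ∑ y ∈ Q', (v x - v y) ^ 2 + N * ∑ z ∈ W, (u z - v z) ^ 2)) := by
    calc _ ≤ L * #W * ∑ x ∈ Q, ∑ y ∈ Q', (u x - v y) ^ 2 := by gcongr
      _ = L * (#W * ∑ x ∈ Q, ∑ y ∈ Q', (u x - v y) ^ 2) := by ring
      _ ≤ L * _ := mul_le_mul_of_nonneg_left key hL
      _ = _ := by ring
  exact le_of_mul_le_mul_left h2 hN'

/-- A Poincaré inequality for pairs `(c, η)` with `η` constrained to lie in `Q c`, where the moves
change `c` alone or `η` alone. Any two of the sets `Q c` are required to overlap. -/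
theorem sigma {C : Type*} (A : Finset C) {Q : C → Finset Y} {R : Y → Y → Prop} {κ L : ℝ} {N : ℕ}
    (hκ : 1 ≤ κ) (hL : 0 ≤ L) (hQ : ∀ c, #(Q c) = N)
    (hW : ∀ c c', (N : ℝ) ≤ L * #(Q c ∩ Q c')) (h : ∀ c, PoincareOn (Q c) R κ) :
    PoincareOn (A.sigma Q) (fun p p' : Σ _ : C, Y =>
      (p.1 ≠ p'.1 ∧ p.2 = p'.2) ∨ (p.1 = p'.1 ∧ R p.2 p'.2)) (6 * L * κ) := by
  intro f
  rcases A.eq_empty_or_nonempty with rfl | hA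
  · simp [sum_sigma]
  have hA1 : (1 : ℝ) ≤ #A := by exact_mod_cast hA.card_pos
  have hcard : #(A.sigma Q) = #A * N := by simp [card_sigma, hQ]
  rw [hcard, Nat.cast_mul]
  simp only [sum_sigma]
  set D : C → ℝ := fun c =>
    ∑ x ∈ Q c, ∑ y ∈ Q c, if R x y then (f ⟨c, x⟩ - f ⟨c, y⟩) ^ 2 else 0 with hD
  set M : C → C → ℝ := fun c c' => ∑ z ∈ Q c ∩ Q c', (f ⟨c, z⟩ - f ⟨c', z⟩) ^ 2 with hM
  have hM0 : ∀ c c', 0 ≤ M c c' := fun c c' => sum_nonneg fun x _ => sq_nonneg _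
  have upper : ∑ c ∈ A, ∑ x ∈ Q c, ∑ c' ∈ A, ∑ y ∈ Q c', (f ⟨c, x⟩ - f ⟨c', y⟩) ^ 2 ≤
      3 * L * (2 * #A * κ * N * ∑ c ∈ A, D c + N * ∑ c ∈ A, ∑ c' ∈ A, M c c') := by
    calc _ = ∑ c ∈ A, ∑ c' ∈ A, ∑ x ∈ Q c, ∑ y ∈ Q c', (f ⟨c, x⟩ - f ⟨c', y⟩) ^ 2 :=
          sum_congr rfl fun c _ => sum_comm
      _ ≤ ∑ c ∈ A, ∑ c' ∈ A, 3 * L * (κ * N * D c + κ * N * D c' + N * M c c') := by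
          refine sum_le_sum fun c _ => sum_le_sum fun c' _ => ?_
          refine (sum_sq_sub_le hL (hQ c) (hQ c') (hW c c') (fun x => f ⟨c, x⟩)
            (fun x => f ⟨c', x⟩)).trans ?_
          have h1 := h c fun x => f ⟨c, x⟩
          have h2 := h c' fun x => f ⟨c', x⟩
          rw [hQ] at h1 h2
          gcongr
      _ = _ := by
          simp only [← mul_sum, sum_add_distrib, sum_const, nsmul_eq_mul]
          ring
  -- Pairs with `c = c'` supply `D`, and pairs with `c ≠ c'`, `x = y` supply `M`; the diagonal `M c
  -- c` is zero.
  have lower : ∑ c ∈ A, D c + ∑ c ∈ A, ∑ c' ∈ A, M c c' ≤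
      ∑ c ∈ A, ∑ x ∈ Q c, ∑ c' ∈ A, ∑ y ∈ Q c',
        if (c ≠ c' ∧ x = y) ∨ (c = c' ∧ R x y) then (f ⟨c, x⟩ - f ⟨c', y⟩) ^ 2 else 0 := by
    rw [← sum_add_distrib]
    refine sum_le_sum fun c hc => ?_
    have e1 : D c = ∑ c' ∈ A, if c = c' then D c else 0 := by rw [sum_ite_eq]; simp [hc]
    rw [e1, sum_comm, ← sum_add_distrib]
    refine sum_le_sum fun c' _ => ?_
    by_cases hcc : c = c'
    · subst hcc
      simp [hM, hD]
    · simp only [hcc, if_false, zero_add, hM, ne_eq, not_false_eq_true, true_and, false_and,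
        or_false]
      simp only [sum_ite_eq]
      rw [← sum_filter, filter_mem_eq_inter]
  have hMs : 0 ≤ ∑ c ∈ A, ∑ c' ∈ A, M c c' :=
    sum_nonneg fun c _ => sum_nonneg fun c' _ => hM0 c c'
  refine upper.trans ?_
  calc 3 * L * (2 * #A * κ * N * ∑ c ∈ A, D c + N * ∑ c ∈ A, ∑ c' ∈ A, M c c')
      ≤ 3 * L * (2 * #A * κ * N * ∑ c ∈ A, D c +
        2 * #A * κ * N * ∑ c ∈ A, ∑ c' ∈ A, M c c') := by
        -- Here `κ ≥ 1` and `A` nonempty let both sums share one coefficient.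
        have : (N : ℝ) ≤ 2 * #A * κ * N := le_mul_of_one_le_left (by positivity) (by nlinarith)
        gcongr
    _ = 6 * L * κ * (#A * N) * (∑ c ∈ A, D c + ∑ c ∈ A, ∑ c' ∈ A, M c c') := by ring
    _ ≤ _ := by
      refine (mul_le_mul_of_nonneg_left lower (by positivity)).trans_eq ?_
      congr!

end PoincareOn

/-! ### From spectral gap to mixing time. -/

section ReversibleChain

open Finset

variable {Ω : Type*} [Fintype Ω]

/-- A symmetric matrix whose quadratic form is bounded by `a` at `u + a⁻¹ P u` and `u - a⁻¹ P u`
contracts the norm of `u` by `a`. -/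
theorem sum_mulVec_sq_le {P : Matrix Ω Ω ℝ} (hsymm : ∀ x y, P x y = P y x) {a : ℝ} (ha : 0 < a)
    {u : Ω → ℝ}
    (hup : ∑ x, (u + a⁻¹ • P.mulVec u) x * P.mulVec (u + a⁻¹ • P.mulVec u) x ≤
      a * ∑ x, (u + a⁻¹ • P.mulVec u) x ^ 2)
    (hlo : -(a * ∑ x, (u - a⁻¹ • P.mulVec u) x ^ 2) ≤
      ∑ x, (u - a⁻¹ • P.mulVec u) x * P.mulVec (u - a⁻¹ • P.mulVec u) x) :
    ∑ x, P.mulVec u x ^ 2 ≤ a ^ 2 * ∑ x, u x ^ 2 := by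
  have hself : ∑ x, P.mulVec (P.mulVec u) x * u x = ∑ x, P.mulVec u x ^ 2 := by
    have hP : P.transpose = P := by ext x y; exact hsymm y x
    have : (P.mulVec (P.mulVec u)) ⬝ᵥ u = P.mulVec u ⬝ᵥ P.mulVec u := by
      rw [dotProduct_comm, Matrix.dotProduct_mulVec, ← Matrix.mulVec_transpose, hP]
    simpa [dotProduct, sq] using this
  simp only [Matrix.mulVec_add, Matrix.mulVec_sub, Matrix.mulVec_smul] at hup hlo
  set w := P.mulVec u with hw
  set z := P.mulVec w with hz
  simp only [Pi.add_apply, Pi.sub_apply, Pi.smul_apply, smul_eq_mul] at hup hlo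
  have e1 : ∑ x, (u x + a⁻¹ * w x) * (w x + a⁻¹ * z x) = ∑ x, u x * w x +
      a⁻¹ * ∑ x, w x ^ 2 + a⁻¹ * ∑ x, z x * u x + a⁻¹ ^ 2 * ∑ x, w x * z x := by
    simp only [mul_sum, ← sum_add_distrib]
    exact sum_congr rfl fun x _ => by ring
  have e2 : ∑ x, (u x - a⁻¹ * w x) * (w x - a⁻¹ * z x) = ∑ x, u x * w x -
      a⁻¹ * ∑ x, w x ^ 2 - a⁻¹ * ∑ x, z x * u x + a⁻¹ ^ 2 * ∑ x, w x * z x := by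
    simp only [mul_sum, ← sum_add_distrib, ← sum_sub_distrib]
    exact sum_congr rfl fun x _ => by ring
  have e3 : ∑ x, (u x + a⁻¹ * w x) ^ 2 + ∑ x, (u x - a⁻¹ * w x) ^ 2 =
      2 * ∑ x, u x ^ 2 + 2 * a⁻¹ ^ 2 * ∑ x, w x ^ 2 := by
    simp only [mul_sum, ← sum_add_distrib]
    exact sum_congr rfl fun x _ => by ring
  rw [e1] at hup
  rw [e2] at hlo
  rw [hself] at hup hlo
  -- Subtract `hlo` from `hup`: the terms `⟨u, w⟩` and `⟨w, z⟩` cancel, and the parallelogram law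
  -- `e3` evaluates the right side. No diagonalisation is needed.
  have h4 : 4 * (a⁻¹ * ∑ x, w x ^ 2) ≤
      a * (2 * ∑ x, u x ^ 2 + 2 * a⁻¹ ^ 2 * ∑ x, w x ^ 2) := by
    rw [← e3]; linarith
  have h5 : a * (2 * ∑ x, u x ^ 2 + 2 * a⁻¹ ^ 2 * ∑ x, w x ^ 2) =
      2 * (a * ∑ x, u x ^ 2) + 2 * (a⁻¹ * ∑ x, w x ^ 2) := by
    field_simp
  rw [h5] at h4
  have h6 : a⁻¹ * ∑ x, w x ^ 2 ≤ a * ∑ x, u x ^ 2 := by linarith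
  calc ∑ x, w x ^ 2 = a * (a⁻¹ * ∑ x, w x ^ 2) := by field_simp
    _ ≤ a * (a * ∑ x, u x ^ 2) := by gcongr
    _ = _ := by ring

/-- A symmetric stochastic matrix with spectral gap at least `g` and diagonal at least `g / 2`
contracts functions of mean zero. -/
theorem sum_mulVec_sq_le_of_gap {P : Matrix Ω Ω ℝ} (hsymm : ∀ x y, P x y = P y x)
    (hnn : ∀ x y, 0 ≤ P x y) (hrow : ∀ x, ∑ y, P x y = 1) {g : ℝ} (hg1 : g < 1)
    (hdiag : ∀ x, g ≤ 2 * P x x)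
    (hgap : ∀ f : Ω → ℝ, g * ∑ x, ∑ y, (f x - f y) ^ 2 ≤
      Fintype.card Ω * ∑ x, ∑ y, P x y * (f x - f y) ^ 2)
    {u : Ω → ℝ} (hu : ∑ x, u x = 0) :
    ∑ x, P.mulVec u x ^ 2 ≤ (1 - g) ^ 2 * ∑ x, u x ^ 2 := by
  have hcol : ∀ y, ∑ x, P x y = 1 := fun y => by
    rw [← hrow y]
    exact sum_congr rfl fun x _ => hsymm x y
  have hform : ∀ (f : Ω → ℝ) (s : ℝ), ∑ x, ∑ y, P x y * (f x + s * f y) ^ 2 =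
      (1 + s ^ 2) * ∑ x, f x ^ 2 + 2 * s * ∑ x, f x * P.mulVec f x := by
    intro f s
    have h1 : ∑ x, ∑ y, P x y * f x ^ 2 = ∑ x, f x ^ 2 :=
      sum_congr rfl fun x _ => by rw [← sum_mul, hrow, one_mul]
    have h2 : ∑ x, ∑ y, P x y * f y ^ 2 = ∑ x, f x ^ 2 := by
      rw [sum_comm]
      exact sum_congr rfl fun x _ => by rw [← sum_mul, hcol, one_mul]
    have h3 : ∑ x, ∑ y, P x y * (f x * f y) = ∑ x, f x * P.mulVec f x := by
      refine sum_congr rfl fun x _ => ?_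
      rw [Matrix.mulVec, dotProduct, mul_sum]
      exact sum_congr rfl fun y _ => by ring
    calc _ = ∑ x, ∑ y, (P x y * f x ^ 2 + s ^ 2 * (P x y * f y ^ 2) +
          2 * s * (P x y * (f x * f y))) :=
          sum_congr rfl fun x _ => sum_congr rfl fun y _ => by ring
      _ = _ := by
          simp only [sum_add_distrib, ← mul_sum, h1, h2, h3]
          ring
  have hw : ∑ x, P.mulVec u x = 0 := by
    simp only [Matrix.mulVec, dotProduct]
    rw [sum_comm, ← hu]
    exact sum_congr rfl fun x _ => by rw [← sum_mul, hcol, one_mul]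
  refine sum_mulVec_sq_le hsymm (by linarith) ?_ ?_
  -- Upper bound: for mean-zero `f` the gap inequality says `⟨f, P f⟩ ≤ (1 - g) ‖f‖²`.
  · set f := u + (1 - g)⁻¹ • P.mulVec u with hf
    have hf0 : ∑ x, f x = 0 := by
      simp [hf, sum_add_distrib, ← mul_sum, hu, hw]
    rcases isEmpty_or_nonempty Ω with hΩ | hΩ
    · simp
    have hpos : (0 : ℝ) < Fintype.card Ω := by exact_mod_cast Fintype.card_pos
    have h1 := hgap f
    have h2 := hform f (-1)
    have h3 : ∑ x, ∑ y, (f x - f y) ^ 2 = 2 * Fintype.card Ω * ∑ x, f x ^ 2 := by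
      calc _ = ∑ x, ∑ y, (f x ^ 2 + f y ^ 2 - 2 * (f x * f y)) :=
            sum_congr rfl fun x _ => sum_congr rfl fun y _ => by ring
        _ = _ := by
            simp only [sum_add_distrib, sum_sub_distrib, ← mul_sum, hf0, sum_const, nsmul_eq_mul,
              card_univ, mul_zero]
            ring
    have h4 : ∑ x, ∑ y, P x y * (f x - f y) ^ 2 = ∑ x, ∑ y, P x y * (f x + -1 * f y) ^ 2 :=
      sum_congr rfl fun x _ => sum_congr rfl fun y _ => by ring
    rw [h3, h4, h2] at h1
    have h5 : (Fintype.card Ω : ℝ) * (2 * (g * ∑ x, f x ^ 2)) ≤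
        Fintype.card Ω * (2 * ∑ x, f x ^ 2 - 2 * ∑ x, f x * P.mulVec f x) := by linarith
    have h6 := le_of_mul_le_mul_left h5 hpos
    linarith
  -- Lower bound: the diagonal terms of `∑ P x y (f x + f y)²` alone give `2g ‖f‖²`, which keeps the
  -- spectrum away from `-1` without a lazy chain.
  · set f := u - (1 - g)⁻¹ • P.mulVec u
    have h1 := hform f 1
    have h2 : 2 * g * ∑ x, f x ^ 2 ≤ ∑ x, ∑ y, P x y * (f x + 1 * f y) ^ 2 := by
      rw [mul_sum]
      refine sum_le_sum fun x _ => ?_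
      calc 2 * g * f x ^ 2 ≤ P x x * (f x + 1 * f x) ^ 2 := by
            nlinarith [hdiag x, sq_nonneg (f x)]
        _ ≤ _ := single_le_sum (f := fun y => P x y * (f x + 1 * f y) ^ 2)
            (fun y _ => mul_nonneg (hnn x y) (sq_nonneg _)) (mem_univ x)
    linarith

/-- The deviation from uniform has L² norm at most 1 initially and contracts by `1 - g` per step.
Cauchy–Schwarz passes to L¹ at the cost of `√|Ω|`, and the condition on `T` makes the result at most
`1 / e`. -/
theorem mixingTime_le_of_gap [DecidableEq Ω] {P : Matrix Ω Ω ℝ} (hsymm : ∀ x y, P x y = P y x)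
    (hnn : ∀ x y, 0 ≤ P x y) (hrow : ∀ x, ∑ y, P x y = 1) {g : ℝ} (hg0 : 0 ≤ g) (hg1 : g < 1)
    (hdiag : ∀ x, g ≤ 2 * P x x)
    (hgap : ∀ f : Ω → ℝ, g * ∑ x, ∑ y, (f x - f y) ^ 2 ≤
      Fintype.card Ω * ∑ x, ∑ y, P x y * (f x - f y) ^ 2)
    {T : ℕ} (hT0 : 0 < T) (hT : 1 + Real.log (Fintype.card Ω) / 2 ≤ g * T) :
    mixingTime P (uniformDist Ω) (1 / (2 * Real.exp 1)) ≤ T := by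
  refine iSup_le fun x => iInf₂_le T ⟨hT0, fun t ht => ?_⟩
  have hZ : (0 : ℝ) < Fintype.card Ω := by exact_mod_cast Fintype.card_pos_iff.2 ⟨x⟩
  set Z : ℝ := (Fintype.card Ω : ℝ) with hZdef
  have hP : P.transpose = P := by ext x y; exact hsymm y x
  -- By symmetry the row vector evolves by `mulVec`.
  have hstep : ∀ s, (fun y => (P ^ (s + 1)) x y - 1 / Z) =
      P.mulVec fun y => (P ^ s) x y - 1 / Z := by
    intro s
    ext y
    simp only [Matrix.mulVec, dotProduct, mul_sub, sum_sub_distrib, ← sum_mul, hrow, one_mul]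
    rw [pow_succ, Matrix.mul_apply]
    congr 1
    exact sum_congr rfl fun z _ => by rw [hsymm z y, mul_comm]
  have hmean : ∀ s, ∑ y, ((P ^ s) x y - 1 / Z) = 0 := by
    intro s
    induction s with
    | zero =>
      simp only [pow_zero, sum_sub_distrib, Matrix.one_apply, sum_ite_eq, mem_univ, if_true,
        sum_const, nsmul_eq_mul, card_univ, ← hZdef]
      field_simp
      simp
    | succ s ih =>
      have h := hstep s
      have h1 : ∀ y, (P ^ (s + 1)) x y - 1 / Z =
          P.mulVec (fun y => (P ^ s) x y - 1 / Z) y := congrFun h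
      simp only [h1, Matrix.mulVec, dotProduct]
      rw [sum_comm, ← ih]
      refine sum_congr rfl fun z _ => ?_
      rw [← sum_mul, sum_congr rfl fun y _ => hsymm y z, hrow, one_mul]
  have hnorm : ∀ s, ∑ y, ((P ^ s) x y - 1 / Z) ^ 2 ≤ ((1 - g) ^ s) ^ 2 := by
    intro s
    induction s with
    | zero =>
      have : ∀ y, ((P ^ 0) x y - 1 / Z) ^ 2 =
          (if x = y then 1 - 2 / Z else 0) + 1 / Z ^ 2 := by
        intro y
        simp only [pow_zero, Matrix.one_apply]
        split_ifs <;> ring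
      simp only [this, sum_add_distrib, sum_ite_eq, mem_univ, if_true, sum_const, nsmul_eq_mul,
        card_univ, ← hZdef]
      have h1 : Z * (1 / Z ^ 2) = 1 / Z := by field_simp
      have h2 : 0 < 1 / Z := by positivity
      rw [h1, show (2 : ℝ) / Z = 2 * (1 / Z) by ring]
      simp only [pow_zero, one_pow]
      linarith
    | succ s ih =>
      have h1 : ∀ y, (P ^ (s + 1)) x y - 1 / Z =
          P.mulVec (fun y => (P ^ s) x y - 1 / Z) y := congrFun (hstep s)
      simp only [h1]
      refine (sum_mulVec_sq_le_of_gap hsymm hnn hrow hg1 hdiag hgap (hmean s)).trans ?_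
      calc _ ≤ (1 - g) ^ 2 * ((1 - g) ^ s) ^ 2 := by gcongr
        _ = _ := by ring
  have hcs : (∑ y, |(P ^ t) x y - 1 / Z|) ^ 2 ≤ Z * ((1 - g) ^ t) ^ 2 := by
    refine (sq_sum_le_card_mul_sum_sq (s := univ)).trans ?_
    simp only [sq_abs, card_univ, ← hZdef]
    have := hnorm t
    gcongr
  have hexp : Z * ((1 - g) ^ t) ^ 2 ≤ (Real.exp (-1)) ^ 2 := by
    have h1 : 1 - g ≤ Real.exp (-g) := by linarith [Real.add_one_le_exp (-g)]
    have h2 : (1 - g) ^ t ≤ Real.exp (-(g * t)) := by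
      calc (1 - g) ^ t ≤ Real.exp (-g) ^ t := by
            have : 0 ≤ 1 - g := by linarith
            gcongr
        _ = _ := by rw [← Real.exp_nat_mul]; ring_nf
    have h3 : 0 ≤ (1 - g) ^ t := pow_nonneg (by linarith) _
    have h4 : g * T ≤ g * t := by gcongr
    calc Z * ((1 - g) ^ t) ^ 2 ≤ Real.exp (Real.log Z) * Real.exp (-(g * t)) ^ 2 := by
          rw [Real.exp_log hZ]
          gcongr
      _ = Real.exp (Real.log Z - 2 * (g * t)) := by
          rw [← Real.exp_nat_mul, ← Real.exp_add]; push_cast; ring_nf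
      _ ≤ Real.exp (-2) := Real.exp_le_exp.2 (by linarith)
      _ = _ := by rw [← Real.exp_nat_mul]; norm_num
  have hfin : ∑ y, |(P ^ t) x y - 1 / Z| ≤ Real.exp (-1) :=
    le_of_sq_le_sq (hcs.trans hexp) (Real.exp_pos _).le
  have heq : (1 : ℝ) / (2 * Real.exp 1) = 1 / 2 * Real.exp (-1) := by
    rw [Real.exp_neg]; field_simp
  rw [heq]
  unfold variationDist uniformDist
  exact mul_le_mul_of_nonneg_left hfin (by norm_num)

end ReversibleChain

/-! ### Recursive structure of tree colourings and the induction on height. -/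

section TreeColourings

open Finset

/-- Two functions that differ at exactly one point. -/
def OneDiff {V C : Type*} (x y : V → C) : Prop := ∃ v, x v ≠ y v ∧ ∀ u, u ≠ v → x u = y u

theorem OneDiff.symm {V C : Type*} {x y : V → C} (h : OneDiff x y) : OneDiff y x := by
  obtain ⟨v, hv, h⟩ := h
  exact ⟨v, hv.symm, fun u hu => (h u hu).symm⟩

/-- The root of the complete tree. -/
def treeRoot (b H : ℕ) : TreeVertex b H := ⟨[], Nat.zero_le _⟩

/-- The vertex of the `i`-th subtree below the root that corresponds to `w`. -/
def treeChild {b H : ℕ} (i : Fin b) (w : TreeVertex b H) : TreeVertex b (H + 1) :=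
  ⟨i :: w.1, by simpa using w.2⟩

theorem treeVertex_cases {b H : ℕ} (v : TreeVertex b (H + 1)) :
    v = treeRoot b (H + 1) ∨ ∃ i w, v = treeChild i w := by
  obtain ⟨_ | ⟨i, w⟩, h⟩ := v
  · exact Or.inl rfl
  · exact Or.inr ⟨i, ⟨w, by simpa using h⟩, rfl⟩

theorem treeVertex_zero (b : ℕ) (v : TreeVertex b 0) : v = treeRoot b 0 :=
  Subtype.ext (List.length_eq_zero_iff.1 (Nat.le_zero.1 v.2))

/-- A colouring of the tree of height `H + 1` consists of a colour for the root and of colourings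
of the subtrees. -/
def treeSplit (b H : ℕ) (C : Type*) :
    (Σ _ : C, Fin b → TreeVertex b H → C) ≃ (TreeVertex b (H + 1) → C) where
  toFun p v := match v with
    | ⟨[], _⟩ => p.1
    | ⟨i :: w, h⟩ => p.2 i ⟨w, by simpa using h⟩
  invFun x := ⟨x (treeRoot b (H + 1)), fun i w => x (treeChild i w)⟩
  left_inv _ := rfl
  right_inv x := by
    funext v
    obtain ⟨_ | ⟨i, w⟩, h⟩ := v <;> rfl

@[simp] theorem treeSplit_root {b H : ℕ} {C : Type*} (p : Σ _ : C, Fin b → TreeVertex b H → C) :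
    treeSplit b H C p (treeRoot b (H + 1)) = p.1 := rfl

@[simp] theorem treeSplit_child {b H : ℕ} {C : Type*} (p : Σ _ : C, Fin b → TreeVertex b H → C)
    (i : Fin b) (w : TreeVertex b H) : treeSplit b H C p (treeChild i w) = p.2 i w := rfl

theorem adj_root_child {b H : ℕ} (i : Fin b) :
    (completeTree b (H + 1)).Adj (treeRoot b (H + 1)) (treeChild i (treeRoot b H)) :=
  Or.inl ⟨i, rfl⟩

theorem adj_child_child {b H : ℕ} {i j : Fin b} {u v : TreeVertex b H} :
    (completeTree b (H + 1)).Adj (treeChild i u) (treeChild j v) ↔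
      i = j ∧ (completeTree b H).Adj u v := by
  simp only [completeTree, treeChild, List.cons_append, List.cons.injEq]
  constructor
  · rintro (⟨k, h, h'⟩ | ⟨k, h, h'⟩)
    · exact ⟨h.symm, Or.inl ⟨k, h'⟩⟩
    · exact ⟨h, Or.inr ⟨k, h'⟩⟩
  · rintro ⟨rfl, ⟨k, h⟩ | ⟨k, h⟩⟩
    · exact Or.inl ⟨k, rfl, h⟩
    · exact Or.inr ⟨k, rfl, h⟩

theorem eq_root_of_adj_root_child {b H : ℕ} {i : Fin b} {w : TreeVertex b H}
    (h : (completeTree b (H + 1)).Adj (treeRoot b (H + 1)) (treeChild i w)) :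
    w = treeRoot b H := by
  rcases h with ⟨k, h⟩ | ⟨k, h⟩
  · simp only [treeChild, treeRoot, List.nil_append, List.cons.injEq] at h
    exact Subtype.ext h.2
  · simp [treeChild, treeRoot] at h

theorem proper_treeSplit_iff {b H : ℕ} {C : Type*} (p : Σ _ : C, Fin b → TreeVertex b H → C) :
    (∀ u v, (completeTree b (H + 1)).Adj u v → treeSplit b H C p u ≠ treeSplit b H C p v) ↔
      ∀ i, (∀ u v, (completeTree b H).Adj u v → p.2 i u ≠ p.2 i v) ∧
        p.2 i (treeRoot b H) ≠ p.1 := by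
  constructor
  · intro h i
    exact ⟨fun u v huv => h (treeChild i u) (treeChild i v) (adj_child_child.2 ⟨rfl, huv⟩),
      (h _ _ (adj_root_child i)).symm⟩
  · intro h u v huv
    rcases treeVertex_cases u with rfl | ⟨i, u, rfl⟩ <;>
      rcases treeVertex_cases v with rfl | ⟨j, v, rfl⟩
    · exact absurd huv (SimpleGraph.irrefl _)
    · rw [eq_root_of_adj_root_child huv]
      exact (h j).2.symm
    · rw [eq_root_of_adj_root_child huv.symm]
      exact (h i).2
    · obtain ⟨rfl, huv'⟩ := adj_child_child.1 huv
      exact (h i).1 u v huv'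

open Classical in
/-- The proper colourings of `G` in which the colour of `r` lies in `A`. -/
noncomputable def properColourings {V : Type*} [Fintype V] {C : Type*} [Fintype C] (G : SimpleGraph V) (r : V)
    (A : Finset C) : Finset (V → C) :=
  {x | (∀ u v, G.Adj u v → x u ≠ x v) ∧ x r ∈ A}

section Symmetry

variable {V : Type*} [Fintype V] {C : Type*} [Fintype C] (G : SimpleGraph V) (r : V)

theorem mem_properColourings {A : Finset C} {x : V → C} :
    x ∈ properColourings G r A ↔ (∀ u v, G.Adj u v → x u ≠ x v) ∧ x r ∈ A := by
  simp [properColourings]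

/-- Permuting the colours preserves properness. -/
theorem card_properColourings_le [DecidableEq C] {A B : Finset C} (σ : Equiv.Perm C)
    (h : ∀ c ∈ A, σ c ∈ B) :
    #(properColourings G r A) ≤ #(properColourings G r B) := by
  refine card_le_card_of_injOn (fun x v => σ (x v)) (fun x hx => ?_) fun x _ y _ hxy => ?_
  · rw [mem_coe, mem_properColourings] at hx ⊢
    exact ⟨fun u v huv e => hx.1 u v huv (σ.injective e), h _ hx.2⟩
  · funext v
    exact σ.injective (congrFun hxy v)

variable [DecidableEq C]

theorem card_properColourings_compl_singleton (c c' : C) :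
    #(properColourings G r {c}ᶜ) = #(properColourings G r {c'}ᶜ) := by
  have key : ∀ c c' : C, #(properColourings G r {c}ᶜ) ≤ #(properColourings G r {c'}ᶜ) := by
    intro c c'
    refine card_properColourings_le G r (Equiv.swap c c') fun d hd => ?_
    simp only [mem_compl, mem_singleton] at hd ⊢
    intro h
    exact hd ((Equiv.swap c c').injective (by rw [h, Equiv.swap_apply_left]))
  exact le_antisymm (key _ _) (key _ _)

/-- A colouring lost from the intersection has root colour `c'`. Swapping `c'` with a third colour
`d` injects these into colourings with root colour `d`, which all lie in the intersection. -/
theorem card_properColourings_inter (hC : 3 ≤ Fintype.card C) (c c' : C) :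
    #(properColourings G r {c}ᶜ) ≤
      2 * #(properColourings G r {c}ᶜ ∩ properColourings G r {c'}ᶜ) := by
  classical
  obtain ⟨d, hd⟩ : ∃ d, d ∉ ({c, c'} : Finset C) := by
    by_contra! h
    have h1 : ({c, c'} : Finset C) = univ := eq_univ_of_forall h
    have h2 : #({c, c'} : Finset C) ≤ 2 := card_le_two
    rw [h1, card_univ] at h2
    omega
  simp only [mem_insert, mem_singleton, not_or] at hd
  have h1 : #(properColourings G r {c'}) ≤ #(properColourings G r {d}) :=
    card_properColourings_le G r (Equiv.swap c' d) (by simp)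
  have h2 : properColourings G r {d} ⊆ properColourings G r {c}ᶜ ∩ properColourings G r {c'}ᶜ := by
    intro x
    simp only [mem_inter, mem_properColourings, mem_singleton, mem_compl]
    rintro ⟨hx, rfl⟩
    exact ⟨⟨hx, hd.1⟩, hx, hd.2⟩
  have h3 : properColourings G r {c}ᶜ ⊆
      (properColourings G r {c}ᶜ ∩ properColourings G r {c'}ᶜ) ∪ properColourings G r {c'} := by
    intro x
    simp only [mem_union, mem_inter, mem_properColourings, mem_singleton, mem_compl]
    tauto
  have h4 := (card_le_card h3).trans (card_union_le _ _)
  have h5 := card_le_card h2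
  omega

end Symmetry

/-- Conditional independence of the subtrees given the root colour, in the form required by
`PoincareOn.sigma`. -/
theorem map_treeSplit_sigma {b H q : ℕ} (A : Finset (Fin q)) :
    (A.sigma fun c => Fintype.piFinset fun _ : Fin b =>
      properColourings (completeTree b H) (treeRoot b H) {c}ᶜ).map
        (treeSplit b H (Fin q)).toEmbedding =
      properColourings (completeTree b (H + 1)) (treeRoot b (H + 1)) A := by
  ext x
  obtain ⟨p, rfl⟩ := (treeSplit b H (Fin q)).surjective x
  rw [mem_map_equiv, Equiv.symm_apply_apply, mem_properColourings, proper_treeSplit_iff,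
    treeSplit_root, mem_sigma, Fintype.mem_piFinset, and_comm]
  simp [mem_properColourings]

/-- The Poincaré inequality for the proper colourings of the complete tree whose root has a colour
in a given set. -/
theorem poincareOn_properColourings {q : ℕ} (hq : 3 ≤ q) (b H : ℕ) (A : Finset (Fin q)) :
    PoincareOn (properColourings (completeTree b H) (treeRoot b H) A) OneDiff
      ((6 * 4 ^ b) ^ H) := by
  -- The subtrees need `A = {c}ᶜ`, even when the whole tree has `A = univ`.
  induction H generalizing A with
  | zero =>
    rw [pow_zero]
    refine PoincareOn.of_forall_ne fun x y hxy => ⟨treeRoot b 0, fun h => hxy ?_, fun u hu => ?_⟩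
    · funext v
      rw [treeVertex_zero b v, h]
    · exact absurd (treeVertex_zero b u) hu
  | succ H ih =>
    set κ : ℝ := (6 * 4 ^ b) ^ H
    have hκ : 1 ≤ κ := one_le_pow₀ (by nlinarith [one_le_pow₀ (n := b) (by norm_num : (1 : ℝ) ≤ 4)])
    have h2b : (1 : ℝ) ≤ 2 ^ b := one_le_pow₀ (by norm_num)
    let U : Fin q → Finset (TreeVertex b H → Fin q) := fun c =>
      properColourings (completeTree b H) (treeRoot b H) {c}ᶜ
    let c₀ : Fin q := ⟨0, by omega⟩
    have hU : ∀ c, #(U c) = #(U c₀) := fun c => card_properColourings_compl_singleton _ _ _ _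
    have hinter : ∀ c c', #(U c₀) ≤ 2 * #(U c ∩ U c') := fun c c' => by
      rw [← hU c]
      exact card_properColourings_inter _ _ (by simpa using hq) c c'
    -- Here `κ := 2 ^ b * κ` comes from `pi`, and `L := 2 ^ b` is the overlap ratio 2 raised to the
    -- number of subtrees.
    have h := (PoincareOn.sigma A (Q := fun c => Fintype.piFinset fun _ : Fin b => U c)
      (R := PoincareOn.Coord OneDiff) (κ := 2 ^ b * κ) (L := 2 ^ b) (N := #(U c₀) ^ b)
      (by nlinarith) (by positivity)
      (fun c => by simp [hU c])
      (fun c c' => by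
        have e : ((Fintype.piFinset fun _ : Fin b => U c) ∩ Fintype.piFinset fun _ : Fin b => U c')
            = Fintype.piFinset fun _ : Fin b => U c ∩ U c' := by
          ext x
          simp [forall_and]
        have h1 : (#(U c₀) : ℝ) ≤ 2 * #(U c ∩ U c') := by exact_mod_cast hinter c c'
        have h2 : (#(Fintype.piFinset fun _ : Fin b => U c ∩ U c') : ℝ) = #(U c ∩ U c') ^ b := by
          simp
        calc ((#(U c₀) ^ b : ℕ) : ℝ) = (#(U c₀) : ℝ) ^ b := by push_cast; rfl
          _ ≤ (2 * #(U c ∩ U c') : ℝ) ^ b := by gcongr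
          _ = 2 ^ b * #(Fintype.piFinset fun _ : Fin b => U c ∩ U c') := by rw [h2, mul_pow]
          _ = _ := by rw [← e]; congr!)
      (fun c => (ih _).pi (by positivity) b)).transport (by positivity)
        (treeSplit b H (Fin q)).toEmbedding (R' := OneDiff) (by
          rintro ⟨c, η⟩ ⟨c', η'⟩ (⟨h, h'⟩ | ⟨h, i, ⟨w, hw, hw'⟩, h'⟩)
          · refine ⟨treeRoot b (H + 1), h, fun u hu => ?_⟩
            rcases treeVertex_cases u with rfl | ⟨i, u, rfl⟩
            · exact absurd rfl hu
            · exact congrFun (congrFun h' i) u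
          · refine ⟨treeChild i w, hw, fun u hu => ?_⟩
            rcases treeVertex_cases u with rfl | ⟨j, u, rfl⟩
            · exact h
            · by_cases hj : j = i
              · subst hj
                exact hw' u fun e => hu (by rw [e])
              · exact congrFun (h' j hj) u)
    rw [map_treeSplit_sigma] at h
    have e : (6 : ℝ) * 2 ^ b * (2 ^ b * κ) = (6 * 4 ^ b) ^ (H + 1) := by
      have h4 : (4 : ℝ) ^ b = 2 ^ b * 2 ^ b := by
        rw [← mul_pow]
        norm_num
      rw [pow_succ']
      change _ = _ * κ
      rw [h4]
      ring
    rwa [e] at h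

end TreeColourings

/-! ### The Metropolis chain: symmetry, holding probability and gap. -/

section GlauberDynamics

open Finset
open scoped Classical

theorem map_coe_coloring {V : Type*} [Fintype V] {G : SimpleGraph V} {q : ℕ}
    [Fintype (G.Coloring (Fin q))] (r : V) :
    (univ : Finset (G.Coloring (Fin q))).map
      (⟨fun x => x, DFunLike.coe_injective⟩ : G.Coloring (Fin q) ↪ (V → Fin q)) =
      properColourings G r univ := by
  ext x
  simp only [mem_map, mem_univ, true_and, mem_properColourings, and_true,
    Function.Embedding.coeFn_mk]
  constructor
  · rintro ⟨y, rfl⟩ u v huv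
    exact y.valid huv
  · exact fun h => ⟨SimpleGraph.Coloring.mk x (fun {u v} huv => h u v huv), rfl⟩

variable {V : Type*} [Fintype V] [DecidableEq V] {G : SimpleGraph V} {q : ℕ}

theorem metropolisMove_eq_iff {x y : G.Coloring (Fin q)} (hxy : x ≠ y) (p : V × Fin q) :
    metropolisMove G q x p = y ↔ Function.update x p.1 p.2 = y := by
  unfold metropolisMove
  split_ifs with h
  · exact ⟨fun e => by rw [← e]; rfl, fun e => DFunLike.coe_injective e⟩
  · refine ⟨fun e => absurd e hxy, fun e => absurd (fun u v huv => ?_) h⟩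
    rw [e]
    exact y.valid huv

theorem metropolisMove_self (x : G.Coloring (Fin q)) (v : V) :
    metropolisMove G q x (v, x v) = x := by
  unfold metropolisMove
  split_ifs with h
  · exact DFunLike.coe_injective (Function.update_eq_self v x)
  · rfl

/-- Only `(v, y v)`, with `v` the vertex of disagreement, leads from `x` to `y`; it is accepted
because `y` is proper. -/
theorem card_metropolisMove_eq {x y : G.Coloring (Fin q)} (hxy : x ≠ y) :
    #{p : V × Fin q | metropolisMove G q x p = y} = if OneDiff x y then 1 else 0 := by
  have hne : (x : V → Fin q) ≠ y := fun e => hxy (DFunLike.coe_injective e)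
  simp only [metropolisMove_eq_iff hxy]
  split_ifs with h
  · obtain ⟨v, hv, h⟩ := h
    rw [card_eq_one]
    refine ⟨(v, y v), ?_⟩
    ext ⟨w, c⟩
    simp only [mem_filter, mem_univ, true_and, mem_singleton, Prod.mk.injEq]
    constructor
    · intro e
      have hw : v = w := by
        by_contra hvw
        exact hv (by rw [← e, Function.update_of_ne hvw])
      subst hw
      exact ⟨rfl, by rw [← e, Function.update_self]⟩
    · rintro ⟨rfl, rfl⟩
      funext u
      by_cases hu : u = w
      · subst hu
        rw [Function.update_self]
      · rw [Function.update_of_ne hu, h u hu]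
  · rw [card_eq_zero, filter_eq_empty_iff]
    rintro ⟨w, c⟩ _ e
    refine h ⟨w, fun hw => hne ?_, fun u hu => by rw [← e, Function.update_of_ne hu]⟩
    rw [← e, eq_comm, Function.update_eq_self_iff, hw, ← e, Function.update_self]

theorem glauberMatrix_of_ne {x y : G.Coloring (Fin q)} (hxy : x ≠ y) :
    glauberMatrix G q x y = (if OneDiff x y then 1 else 0) / (Fintype.card V * q) := by
  unfold glauberMatrix
  rw [card_metropolisMove_eq hxy]
  simp

theorem glauberMatrix_symm (x y : G.Coloring (Fin q)) :
    glauberMatrix G q x y = glauberMatrix G q y x := by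
  by_cases h : x = y
  · rw [h]
  · rw [glauberMatrix_of_ne h, glauberMatrix_of_ne (Ne.symm h)]
    congr 2
    exact propext ⟨OneDiff.symm, OneDiff.symm⟩

theorem glauberMatrix_nonneg (x y : G.Coloring (Fin q)) : 0 ≤ glauberMatrix G q x y := by
  unfold glauberMatrix
  positivity

theorem glauberMatrix_row [Nonempty V] (hq : 0 < q) [Fintype (G.Coloring (Fin q))]
    (x : G.Coloring (Fin q)) : ∑ y, glauberMatrix G q x y = 1 := by
  unfold glauberMatrix
  rw [← sum_div, ← Nat.cast_sum, ← card_eq_sum_card_fiberwise (fun _ _ => mem_coe.2 (mem_univ _)),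
    card_univ, Fintype.card_prod, Fintype.card_fin, Nat.cast_mul]
  have : (0 : ℝ) < Fintype.card V := by exact_mod_cast Fintype.card_pos
  have : (0 : ℝ) < q := by exact_mod_cast hq
  exact div_self (by positivity)

/-- Selecting a vertex with its current colour changes nothing, which accounts for `n` of the `n *
q` choices. -/
theorem inv_le_glauberMatrix_self [Nonempty V] (hq : 0 < q) (x : G.Coloring (Fin q)) :
    (q : ℝ)⁻¹ ≤ glauberMatrix G q x x := by
  unfold glauberMatrix
  have hV : (0 : ℝ) < Fintype.card V := by exact_mod_cast Fintype.card_pos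
  have hq : (0 : ℝ) < q := by exact_mod_cast hq
  have h : Fintype.card V ≤ #{p : V × Fin q | metropolisMove G q x p = x} := by
    rw [← card_univ]
    refine card_le_card_of_injOn (fun v => (v, x v)) (fun v _ => ?_) fun v _ w _ h => ?_
    · simp [metropolisMove_self]
    · exact congrArg Prod.fst h
  rw [le_div_iff₀ (by positivity)]
  calc (q : ℝ)⁻¹ * (Fintype.card V * q) = Fintype.card V := by field_simp
    _ ≤ _ := by exact_mod_cast h

theorem glauber_gap [Nonempty V] (hq : 0 < q) (r : V) [Fintype (G.Coloring (Fin q))] {κ : ℝ}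
    (hκ : 0 < κ) (h : PoincareOn (properColourings G r (univ : Finset (Fin q))) OneDiff κ)
    (f : G.Coloring (Fin q) → ℝ) :
    (Fintype.card V * q * κ)⁻¹ * ∑ x, ∑ y, (f x - f y) ^ 2 ≤
      Fintype.card (G.Coloring (Fin q)) *
        ∑ x, ∑ y, glauberMatrix G q x y * (f x - f y) ^ 2 := by
  have hV : (0 : ℝ) < Fintype.card V := by exact_mod_cast Fintype.card_pos
  have hq : (0 : ℝ) < q := by exact_mod_cast hq
  rw [← map_coe_coloring] at h
  -- The value 0 off the proper colourings is irrelevant: the sums range only over the image.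
  have h1 := h (Function.extend (fun x : G.Coloring (Fin q) => (x : V → Fin q)) f 0)
  simp only [sum_map, card_map, card_univ, Function.Embedding.coeFn_mk,
    DFunLike.coe_injective.extend_apply] at h1
  have h2 : ∑ x : G.Coloring (Fin q), ∑ y : G.Coloring (Fin q),
      (if OneDiff x y then (f x - f y) ^ 2 else 0) =
      Fintype.card V * q * ∑ x, ∑ y, glauberMatrix G q x y * (f x - f y) ^ 2 := by
    simp only [mul_sum]
    refine sum_congr rfl fun x _ => sum_congr rfl fun y _ => ?_
    by_cases hxy : x = y
    · subst hxy
      simp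
    · rw [glauberMatrix_of_ne hxy]
      split_ifs
      · field_simp
      · simp
  rw [h2] at h1
  rw [inv_mul_le_iff₀ (by positivity)]
  linarith

theorem card_coloring_le [Fintype (G.Coloring (Fin q))] :
    Fintype.card (G.Coloring (Fin q)) ≤ q ^ Fintype.card V := by
  have := Fintype.card_le_of_injective (fun x : G.Coloring (Fin q) => (x : V → Fin q))
    DFunLike.coe_injective
  simpa using this

theorem glauberMixingTime_le [Nonempty V] (hq : 2 ≤ q) (r : V) {κ : ℝ} (hκ : 1 ≤ κ)
    (h : PoincareOn (properColourings G r (univ : Finset (Fin q))) OneDiff κ) {T : ℕ}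
    (hT : (1 + Fintype.card V * Real.log q / 2) * (Fintype.card V * q * κ) ≤ T) :
    glauberMixingTime G q (1 / (2 * Real.exp 1)) ≤ T := by
  have hV : (1 : ℝ) ≤ Fintype.card V := by exact_mod_cast Fintype.card_pos
  have hq2 : (2 : ℝ) ≤ q := by exact_mod_cast hq
  have hVq : (q : ℝ) ≤ Fintype.card V * q := le_mul_of_one_le_left (by linarith) hV
  have hD : (q : ℝ) ≤ Fintype.card V * q * κ := hVq.trans (le_mul_of_one_le_right (by linarith) hκ)
  have hlog : 0 ≤ Real.log q := Real.log_nonneg (by linarith)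
  refine mixingTime_le_of_gap (g := (Fintype.card V * q * κ)⁻¹) glauberMatrix_symm
    glauberMatrix_nonneg (glauberMatrix_row (by omega)) (by positivity)
    (inv_lt_one_of_one_lt₀ (by linarith)) (fun x => ?_)
    (glauber_gap (by omega) r (by linarith) h) ?_ ?_
  · have h1 := inv_le_glauberMatrix_self (by omega) x
    have h2 : (Fintype.card V * q * κ)⁻¹ ≤ (q : ℝ)⁻¹ := inv_anti₀ (by linarith) hD
    have h3 : 0 < (q : ℝ)⁻¹ := by positivity
    linarith
  · have : (0 : ℝ) < T := lt_of_lt_of_le (by positivity) hT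
    exact_mod_cast this
  · rw [inv_mul_eq_div, le_div_iff₀ (by positivity)]
    refine le_trans ?_ hT
    gcongr
    -- For a general graph there may be no colouring; then `Real.log 0 = 0` suffices.
    rcases Nat.eq_zero_or_pos (Fintype.card (G.Coloring (Fin q))) with h0 | h0
    · rw [h0]
      simp only [Nat.cast_zero, Real.log_zero]
      positivity
    · rw [← Real.log_pow]
      refine Real.log_le_log (by exact_mod_cast h0) ?_
      exact_mod_cast card_coloring_le

end GlauberDynamics

/-! ### Numerical estimates in terms of `n`. -/

section Estimates

instance instNonemptyTreeVertex (b H : ℕ) : Nonempty (TreeVertex b H) := ⟨treeRoot b H⟩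

/-- Counts the leaves alone. -/
theorem pow_le_card_treeVertex (b H : ℕ) : b ^ H ≤ Fintype.card (TreeVertex b H) := by
  have := Fintype.card_le_of_injective
    (fun w : Fin H → Fin b => (⟨List.ofFn w, by simp⟩ : TreeVertex b H))
    fun v w h => List.ofFn_injective (congrArg Subtype.val h)
  simpa using this

/-- Uses `6 ≤ 4 ^ b` and `16 ≤ e³`; this is the source of the 3 in the exponent `3b / ln b`. -/
theorem six_mul_four_pow_le_exp {b : ℕ} (hb : 2 ≤ b) :
    (6 * 4 ^ b : ℝ) ≤ Real.exp (3 * b) := by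
  have h1 : (16 : ℝ) ≤ Real.exp 3 := by
    have h := Real.exp_one_gt_d9
    calc (16 : ℝ) ≤ 2.7 ^ 3 := by norm_num
      _ ≤ Real.exp 1 ^ 3 := by gcongr; linarith
      _ = Real.exp 3 := by rw [← Real.exp_nat_mul]; norm_num
  calc (6 * 4 ^ b : ℝ) ≤ 4 ^ b * 4 ^ b := by
        gcongr
        calc (6 : ℝ) ≤ 4 ^ 2 := by norm_num
          _ ≤ 4 ^ b := pow_le_pow_right₀ (by norm_num) hb
    _ = 16 ^ b := by rw [← mul_pow]; norm_num
    _ ≤ Real.exp 3 ^ b := by gcongr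
    _ = _ := by rw [← Real.exp_nat_mul]; ring_nf

theorem pow_height_le_rpow_card {b H : ℕ} (hb : 2 ≤ b) :
    ((6 * 4 ^ b : ℝ)) ^ H ≤
      (Fintype.card (TreeVertex b H) : ℝ) ^ (3 * (b : ℝ) / Real.log b) := by
  have hb' : (1 : ℝ) < b := by exact_mod_cast hb
  have hlog : 0 < Real.log b := Real.log_pos hb'
  calc ((6 * 4 ^ b : ℝ)) ^ H ≤ Real.exp (3 * b) ^ H := by
        gcongr
        exact six_mul_four_pow_le_exp hb
    _ = ((b ^ H : ℕ) : ℝ) ^ (3 * (b : ℝ) / Real.log b) := by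
        rw [Real.rpow_def_of_pos (by positivity), ← Real.exp_nat_mul]
        push_cast
        rw [Real.log_pow]
        congr 1
        field_simp
    _ ≤ _ := by
        gcongr
        exact_mod_cast pow_le_card_treeVertex b H

theorem exists_glauberMixingTime_eq {q b : ℕ} (H : ℕ) (hq : 3 ≤ q) (hb : 2 ≤ b) :
    ∃ t : ℕ, glauberMixingTime (completeTree b H) q (1 / (2 * Real.exp 1)) = (t : ℕ∞) ∧
      (t : ℝ) ≤ 3 * (b : ℝ) * (q : ℝ) ^ 2 *
        (1 + Real.logb 2 (Fintype.card (TreeVertex b H) : ℝ)) *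
        (Fintype.card (TreeVertex b H) : ℝ) ^ (3 + 3 * (b : ℝ) / Real.log (b : ℝ)) := by
  set n : ℝ := (Fintype.card (TreeVertex b H) : ℝ) with hn
  have hn1 : 1 ≤ n := Nat.one_le_cast.2 Fintype.card_pos
  have hq3 : (3 : ℝ) ≤ q := by exact_mod_cast hq
  have hb2 : (2 : ℝ) ≤ b := by exact_mod_cast hb
  set κ : ℝ := (6 * 4 ^ b) ^ H with hκdef
  have hκ : 1 ≤ κ :=
    one_le_pow₀ (by nlinarith [one_le_pow₀ (n := b) (by norm_num : (1 : ℝ) ≤ 4)])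
  have hlog : Real.log q ≤ q := Real.log_le_self (by linarith)
  have hlog0 : 0 ≤ Real.log q := Real.log_nonneg (by linarith)
  set T := ⌈(1 + n * Real.log q / 2) * (n * q * κ)⌉₊ with hT
  have hle := glauberMixingTime_le (by omega) (treeRoot b H) hκ
    (poincareOn_properColourings hq b H Finset.univ) (Nat.le_ceil _ : _ ≤ (T : ℝ))
  obtain ⟨t, ht, htT⟩ := ENat.le_natCast_iff.1 hle
  refine ⟨t, ht, ?_⟩
  have hE : κ ≤ n ^ (3 * (b : ℝ) / Real.log b) := pow_height_le_rpow_card hb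
  have hlg : 0 ≤ Real.logb 2 n := Real.logb_nonneg (by norm_num) hn1
  have hnq : 1 ≤ n * q := by nlinarith
  have hnqκ : 1 ≤ n * q * κ := by nlinarith
  rw [Real.rpow_add (by linarith), show ((3 : ℝ)) = ((3 : ℕ) : ℝ) by norm_num,
    Real.rpow_natCast]
  push_cast
  calc (t : ℝ) ≤ T := by exact_mod_cast htT
    _ ≤ (1 + n * Real.log q / 2) * (n * q * κ) + 1 := (Nat.ceil_lt_add_one (by positivity)).le
    -- The 1 from rounding up is absorbed using `n * q * κ ≥ 1`.
    _ ≤ (n * q + n * q) * (n * q * κ) + 1 * (n * q * κ) := by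
        gcongr
        · nlinarith
        · linarith
    _ ≤ (n * q + n * q) * (n * q * κ) + (n * q) * (n * q * κ) := by gcongr
    -- The bound is really `3 q² n² κ`; the factors `b`, `1 + lg n` and one `n` of the target are
    -- slack.
    _ = 3 * 1 * q ^ 2 * (1 + 0) * (n ^ 2 * κ) := by ring
    _ ≤ 3 * b * q ^ 2 * (1 + Real.logb 2 n) * (n ^ 3 * n ^ (3 * (b : ℝ) / Real.log b)) := by
        gcongr
        · linarith
        · norm_num

theorem two_le_div_log {b : ℕ} (hb : 2 ≤ b) : 2 ≤ (b : ℝ) / Real.log b := by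
  have hb2 : (2 : ℝ) ≤ b := by exact_mod_cast hb
  rw [le_div_iff₀ (Real.log_pos (by linarith))]
  have h1 := Real.log_le_sub_one_of_pos (show (0 : ℝ) < b / 2 by positivity)
  rw [Real.log_div (by positivity) (by norm_num)] at h1
  linarith [Real.log_two_lt_d9]

end Estimates

theorem theorem1 :
    (∃ C : ℝ, 0 < C ∧ ∀ q b : ℕ, 3 ≤ q → 2 ≤ b → ∃ N : ℕ, ∀ H n : ℕ,
      n = Fintype.card (TreeVertex b H) → N ≤ n →
        ∃ t : ℕ, glauberMixingTime (completeTree b H) q (1 / (2 * Real.exp 1)) = (t : ℕ∞) ∧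
          (t : ℝ) ≤ (n : ℝ) ^ (C * ((b : ℝ) / Real.log (b : ℝ)))) ∧
    (∀ q b H n : ℕ, 3 ≤ q → 2 ≤ b → n = Fintype.card (TreeVertex b H) →
      ∃ t : ℕ, glauberMixingTime (completeTree b H) q (1 / (2 * Real.exp 1)) = (t : ℕ∞) ∧
        (t : ℝ) ≤ 3 * (b : ℝ) * (q : ℝ) ^ 2 * (1 + Real.logb 2 (n : ℝ)) *
          (n : ℝ) ^ (3 + 3 * (b : ℝ) / Real.log (b : ℝ))) := by
  -- This `N` forces `3bq² ≤ n` and `n ≥ 2`, so the prefactor is at most `n³`. With `r = b / ln b ≥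
  -- 2` the exponent `6 + 3r` is at most `6r`, whence `C = 6`.
  refine ⟨⟨6, by norm_num, fun q b hq hb => ⟨3 * b * q ^ 2 + 2, fun H n hn hN => ?_⟩⟩,
    fun q b H n hq hb hn => hn ▸ exists_glauberMixingTime_eq H hq hb⟩
  obtain ⟨t, ht, hle⟩ := exists_glauberMixingTime_eq H hq hb
  refine ⟨t, ht, hle.trans ?_⟩
  rw [← hn]
  have hN' : (3 * b * q ^ 2 + 2 : ℝ) ≤ n := by exact_mod_cast hN
  have hbq : (0 : ℝ) ≤ 3 * b * q ^ 2 := by positivity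
  have hn2 : (2 : ℝ) ≤ n := by linarith
  have hlg : Real.logb 2 n ≤ n := by
    rw [Real.logb_le_iff_le_rpow (by norm_num) (by linarith), Real.rpow_natCast]
    exact_mod_cast Nat.lt_two_pow_self.le
  have hlg0 : 0 ≤ Real.logb 2 (n : ℝ) := Real.logb_nonneg (by norm_num) (by linarith)
  have hL := two_le_div_log hb
  set r : ℝ := (b : ℝ) / Real.log b with hr
  have hr3 : 3 * (b : ℝ) / Real.log b = 3 * r := by rw [hr]; ring
  have hnn : (0 : ℝ) < n := by linarith
  calc 3 * (b : ℝ) * q ^ 2 * (1 + Real.logb 2 n) * (n : ℝ) ^ (3 + 3 * (b : ℝ) / Real.log b)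
      ≤ n * n ^ 2 * (n : ℝ) ^ (3 + 3 * (b : ℝ) / Real.log b) := by
        gcongr
        · linarith
        · nlinarith
    _ = (n : ℝ) ^ (3 + (3 + 3 * r)) := by
        have h3 : (n : ℝ) ^ (3 : ℝ) = n ^ 3 := by exact_mod_cast Real.rpow_natCast n 3
        rw [hr3, Real.rpow_add hnn 3 (3 + 3 * r), h3]
        ring
    _ ≤ (n : ℝ) ^ (6 * r) := Real.rpow_le_rpow_of_exponent_le (by linarith) (by linarith)
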